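/- Let $V$ be an infinite set of variables. Formulas of the modal $\mu$-calculus are given by $\varphi ::= \top \mid \bot \mid p \mid \neg p \mid \varphi\wedge\varphi \mid \varphi\vee\varphi \mid \Diamond\varphi \mid \Box\varphi \mid \mu x.\varphi \mid \nu x.\varphi$ with $p,x\in V$, where $\mu x.\varphi$ and $\nu x.\varphi$ may only be formed if $\neg x$ does not occur in $\varphi$. Formulas $\eta x.\chi$ with $\eta\in\{\mu,\nu\}$ are called fixpoint formulas. A formula is *tidy* if no variable is both free and bound in it. *Traces.* Between tidy formulas put $\varphi_0\wedge\varphi_1\to_C\varphi_i$, $\varphi_0\vee\varphi_1\to_C\varphi_i$, $\Diamond\varphi\to_C\varphi$, $\Box\varphi\to_C\varphi$ and $\eta x.\chi\to_C\chi[\eta x.\chi/x]$. A trace is a finite or infinite $\to_C$-path, and $\twoheadrightarrow_C$ is the reflexive-transitive closure of $\to_C$. The cluster $C(\varphi)$ of $\varphi$ consists of all $\psi$ with $\varphi\twoheadrightarrow_C\psi\twoheadrightarrow_C\varphi$. *Closure priority order.* A formula $\varphi$ is a free subformula of $\psi$, written $\varphi\trianglelefteq_f\psi$, if $\psi=\rho[\varphi/x]$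 for some formula $\rho$ and some free variable $x$ of $\rho$ such that $\varphi$ is free for $x$ in $\rho$ (that is, $\neg x$ does not occur in $\rho$ and the substitution captures no free variable of $\varphi$). For tidy $\varphi$ and $\psi$, write $\varphi\sqsubseteq_C\psi$ if there is a finite trace $\psi=\chi_0\to_C\cdots\to_C\chi_n=\varphi$ ($n\ge 0$) with $\psi\trianglelefteq_f\chi_i$ for all $0\le i\le n$, and $\varphi\sqsubset_C\psi$ if $\varphi\sqsubseteq_C\psi$ and $\psi\not\sqsubseteq_C\varphi$. *Priorities.* An alternating chain of length $n$ is a sequence $\eta_1x_1.\chi_1\sqsubset_C\cdots\sqsubset_C\eta_nx_n.\chi_n$ of tidy fixpoint formulas with $\eta_{i+1}\neq\eta_i$ for $1\le i<n$; it starts at $\eta_1x_1.\chi_1$. For a tidy fixpoint formula $\psi=\eta y.\varphi$ let $h^{\uparrow}(\psi)$ be the maximal length of an alternating chain starting at $\psi$, let $\mathit{cd}(C(\psi))$ be the maximal length of an alternating chain in $C(\psi)$, and put $d:=\mathit{cd}(C(\psi))-h^{\uparrow}(\psi)$. Associating odd parity with $\mu$ and even parity with $\nu$, the priority $\Omega_g(\psi)$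 is $d$ if $d$ has the parity of $\eta$, and $d+1$ otherwise. On formulas that are not fixpoint formulas $\Omega_g$ is undefined. **Proposition.** Let $\tau=(\xi_n)_{n\in\omega}$ be an infinite trace of tidy formulas. Then: 1. there is a unique fixpoint formula $\xi=\eta x.\chi$ which occurs infinitely often on $\tau$ and satisfies $\xi_n\sqsubseteq_C\xi$ for cofinitely many $n$; 2. $\max\{\Omega_g(\varphi)\mid\varphi\text{ is a fixpoint formula that occurs infinitely often on }\tau\}$ exists, and it is even if and only if $\eta=\nu$. -/

import Mathlib

namespace ModalMu

/-- The two fixpoint operators. -/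
inductive FixOp where
  | mu
  | nu
  deriving DecidableEq

/-- The opposite fixpoint operator. -/
def FixOp.dual : FixOp → FixOp
  | .mu => .nu
  | .nu => .mu

/-- `mu` is associated with odd, `nu` with even parity. -/
def FixOp.IsParityOf : FixOp → ℕ → Prop
  | .mu, n => Odd n
  | .nu, n => Even n

/-- Raw syntax of the modal `mu`-calculus in negation normal form, over a set `V` of variables.
The positivity constraint on fixpoint formulas is imposed by `Formula.WellFormed` below. -/
inductive Formula (V : Type*) where
  | top : Formula V
  | bot : Formula V
  | var : V → Formula V
  | negVar : V → Formula V
  | conj : Formula V → Formula V → Formula V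
  | disj : Formula V → Formula V → Formula V
  | dia : Formula V → Formula V
  | box : Formula V → Formula V
  | fix : FixOp → V → Formula V → Formula V

namespace Formula

variable {V : Type*} [DecidableEq V]

/-- Free variables. -/
def FV : Formula V → Finset V
  | top => ∅
  | bot => ∅
  | var p => {p}
  | negVar p => {p}
  | conj φ ψ => FV φ ∪ FV ψ
  | disj φ ψ => FV φ ∪ FV ψ
  | dia φ => FV φ
  | box φ => FV φ
  | fix _ x φ => (FV φ).erase x

/-- Bound variables. -/
def BV : Formula V → Finset V
  | top => ∅
  | bot => ∅
  | var _ => ∅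
  | negVar _ => ∅
  | conj φ ψ => BV φ ∪ BV ψ
  | disj φ ψ => BV φ ∪ BV ψ
  | dia φ => BV φ
  | box φ => BV φ
  | fix _ x φ => insert x (BV φ)

/-- `φ.Positive x`: there is no occurrence of the negative literal of `x` in `φ`. -/
def Positive (x : V) : Formula V → Prop
  | top => True
  | bot => True
  | var _ => True
  | negVar p => p ≠ x
  | conj φ ψ => Positive x φ ∧ Positive x ψ
  | disj φ ψ => Positive x φ ∧ Positive x ψ
  | dia φ => Positive x φ
  | box φ => Positive x φ
  | fix _ _ φ => Positive x φ

/-- The formation rule: `fix η x φ` may only be formed if `φ` is positive in `x`. -/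
def WellFormed : Formula V → Prop
  | top => True
  | bot => True
  | var _ => True
  | negVar _ => True
  | conj φ ψ => WellFormed φ ∧ WellFormed ψ
  | disj φ ψ => WellFormed φ ∧ WellFormed ψ
  | dia φ => WellFormed φ
  | box φ => WellFormed φ
  | fix _ x φ => Positive x φ ∧ WellFormed φ

/-- A `mu`-calculus formula is tidy if no variable occurs both free and bound in it. -/
def Tidy (φ : Formula V) : Prop :=
  φ.WellFormed ∧ Disjoint φ.FV φ.BV

/-- Fixpoint formulas. -/
def IsFixpoint (φ : Formula V) : Prop :=
  ∃ η x χ, φ = fix η x χ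

/-- `φ.subst ξ x` is the formula obtained by putting `ξ` for the free occurrences of the
variable `x` in `φ`. No bound variable is renamed; the operation is only meant for, and only
used in, situations where `ξ` is free for `x` in `φ`. -/
def subst (ξ : Formula V) (x : V) : Formula V → Formula V
  | top => top
  | bot => bot
  | var p => if p = x then ξ else var p
  | negVar p => negVar p
  | conj φ ψ => conj (subst ξ x φ) (subst ξ x ψ)
  | disj φ ψ => disj (subst ξ x φ) (subst ξ x ψ)
  | dia φ => dia (subst ξ x φ)
  | box φ => box (subst ξ x φ)
  | fix η y φ => if y = x then fix η y φ else fix η y (subst ξ x φ)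

/-- No free occurrence of `x` in the formula is in the scope of a fixpoint operator that binds
a free variable of `ξ`. -/
def NoCapture (ξ : Formula V) (x : V) : Formula V → Prop
  | top => True
  | bot => True
  | var _ => True
  | negVar _ => True
  | conj φ ψ => NoCapture ξ x φ ∧ NoCapture ξ x ψ
  | disj φ ψ => NoCapture ξ x φ ∧ NoCapture ξ x ψ
  | dia φ => NoCapture ξ x φ
  | box φ => NoCapture ξ x φ
  | fix _ y φ => y = x ∨ ((x ∈ φ.FV → y ∉ ξ.FV) ∧ NoCapture ξ x φ)

/-- `ξ` is free for `x` in `φ`. -/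
def FreeFor (ξ : Formula V) (x : V) (φ : Formula V) : Prop :=
  φ.Positive x ∧ NoCapture ξ x φ

/-- `φ.FreeSub ψ`: `φ` is a free subformula of `ψ`, that is, `ψ` is `ρ[φ/x]` for some
`mu`-calculus formula `ρ` in which `x` occurs freely and `φ` is free for `x`. -/
def FreeSub (φ ψ : Formula V) : Prop :=
  ∃ (ρ : Formula V) (x : V),
    ρ.WellFormed ∧ x ∈ ρ.FV ∧ FreeFor φ x ρ ∧ ψ = subst φ x ρ

/-- One step of the closure construction: a Boolean or modal formula leads to its direct
subformulas, a fixpoint formula to its unfolding. -/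
inductive ClosStep : Formula V → Formula V → Prop
  | conj_left (φ ψ : Formula V) : ClosStep (conj φ ψ) φ
  | conj_right (φ ψ : Formula V) : ClosStep (conj φ ψ) ψ
  | disj_left (φ ψ : Formula V) : ClosStep (disj φ ψ) φ
  | disj_right (φ ψ : Formula V) : ClosStep (disj φ ψ) ψ
  | dia (φ : Formula V) : ClosStep (dia φ) φ
  | box (φ : Formula V) : ClosStep (box φ) φ
  | unfold (η : FixOp) (x : V) (χ : Formula V) :
      ClosStep (fix η x χ) (subst (fix η x χ) x χ)

/-- The trace relation, between tidy formulas. -/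
def TraceArrow (φ ψ : Formula V) : Prop :=
  φ.Tidy ∧ ψ.Tidy ∧ ClosStep φ ψ

/-- There is a (possibly empty) finite trace from `φ` to `ψ`. -/
def Reaches (φ ψ : Formula V) : Prop :=
  Relation.ReflTransGen TraceArrow φ ψ

/-- There is a (possibly empty) finite trace from `ρ` to `σ` such that `ψ` is a free subformula
of every formula on it, including `ρ` and `σ`. -/
def ReachesVia (ψ ρ σ : Formula V) : Prop :=
  FreeSub ψ ρ ∧ Relation.ReflTransGen (fun α β => TraceArrow α β ∧ FreeSub ψ β) ρ σ

/-- The cluster of `φ`: all tidy formulas that are reachable from `φ` and from which `φ` is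
reachable. -/
def cluster (φ : Formula V) : Set (Formula V) :=
  {ψ | ψ.Tidy ∧ Reaches φ ψ ∧ Reaches ψ φ}

/-- The closure priority relation: `ψ` reaches `φ` by a trace on which `ψ` is everywhere a free
subformula. The left argument is not required to be a fixpoint formula. -/
def PrioLE (φ ψ : Formula V) : Prop :=
  ReachesVia ψ ψ φ

/-- The strict part of the closure priority relation. -/
def PrioLT (φ ψ : Formula V) : Prop :=
  PrioLE φ ψ ∧ ¬ PrioLE ψ φ

/-- Consecutive elements of alternating chains: `φ` is strictly below `ψ`, and `φ`, `ψ` are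
fixpoint formulas of opposite type. -/
def AltStep (φ ψ : Formula V) : Prop :=
  PrioLT φ ψ ∧ ∃ η x χ y δ, φ = fix η x χ ∧ ψ = fix η.dual y δ

/-- Alternating chains of tidy fixpoint formulas, listed from the bottom upwards. -/
def IsAltChain (l : List (Formula V)) : Prop :=
  (∀ φ ∈ l, φ.Tidy ∧ φ.IsFixpoint) ∧ l.IsChain AltStep

/-- The maximal length of an alternating chain starting at `φ`. The set is bounded for tidy `φ`,
since chains are strictly increasing and stay in the cluster of `φ`, which is finite. -/
noncomputable def hUp (φ : Formula V) : ℕ :=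
  sSup {n | ∃ l : List (Formula V), IsAltChain l ∧ l.head? = some φ ∧ l.length = n}

/-- The closure depth of a cluster `C`: the maximal length of an alternating chain in `C`. -/
noncomputable def closureDepth (C : Set (Formula V)) : ℕ :=
  sSup {n | ∃ l : List (Formula V), IsAltChain l ∧ (∀ φ ∈ l, φ ∈ C) ∧ l.length = n}

open Classical in
/-- The global priority function, a partial map that is defined on fixpoint formulas only. The
subtraction is not truncated, as a chain starting at a tidy `φ` is a chain in its cluster. -/
noncomputable def globalPriority : Formula V → Option ℕ
  | fix η x χ =>
      let d := closureDepth (cluster (fix η x χ)) - hUp (fix η x χ)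
      some (if η.IsParityOf d then d else d + 1)
  | _ => none

/-- Infinite traces of tidy formulas. -/
def IsInfiniteTrace (τ : ℕ → Formula V) : Prop :=
  (∀ n, (τ n).Tidy) ∧ ∀ n, TraceArrow (τ n) (τ (n + 1))

/-- `φ` occurs infinitely often on `τ`. -/
def OccursInfinitelyOften (τ : ℕ → Formula V) (φ : Formula V) : Prop :=
  {n | τ n = φ}.Infinite

/-- `ξ` is a fixpoint formula that occurs infinitely often on `τ` and is above cofinitely many
elements of `τ` in the closure priority relation. -/
def Dominates (τ : ℕ → Formula V) (ξ : Formula V) : Prop :=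
  ξ.IsFixpoint ∧ OccursInfinitelyOften τ ξ ∧ ∀ᶠ n in Filter.cofinite, PrioLE (τ n) ξ

end Formula

end ModalMu

namespace ModalMu

namespace Formula

variable {V : Type*} [DecidableEq V]

/-! ### Free variables, positivity and substitution -/

theorem positive_of_notMem_FV {z : V} {φ : Formula V} (hφ : φ.WellFormed) (hz : z ∉ φ.FV) :
    φ.Positive z := by
  induction φ with
  | fix η x φ ih =>
    by_cases h : z = x
    · subst h; exact hφ.1
    · exact ih hφ.2 fun hm => hz (Finset.mem_erase.2 ⟨h, hm⟩)
  | _ => simp_all [WellFormed, FV, Positive, eq_comm]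

theorem subst_of_notMem_FV {ξ : Formula V} {x : V} {φ : Formula V} (hx : x ∉ φ.FV) :
    subst ξ x φ = φ := by
  induction φ with
  | fix η y φ ih =>
    by_cases h : y = x
    · simp [subst, h]
    · simp only [subst, h, if_false]
      rw [ih fun hm => hx (Finset.mem_erase.2 ⟨fun e => h e.symm, hm⟩)]
  | var p => rw [subst, if_neg fun e => hx (by simp [FV, e])]
  | _ => simp_all [FV, subst]

theorem Positive.subst {ξ : Formula V} {x z : V} {φ : Formula V} (hφ : φ.Positive z)
    (hξ : ξ.Positive z) : (subst ξ x φ).Positive z := by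
  induction φ with
  | var p => by_cases h : p = x <;> simp [Formula.subst, h, hξ, Positive]
  | fix η y φ ih =>
    by_cases h : y = x
    · simpa [Formula.subst, h] using hφ
    · simpa [Formula.subst, h, Positive] using ih hφ
  | _ => simp_all [Formula.subst, Positive]

theorem WellFormed.subst {ξ : Formula V} {x : V} {φ : Formula V} (hφ : φ.WellFormed)
    (hξ : ξ.WellFormed) (h : ∀ z ∈ φ.BV, z ∉ ξ.FV) : (subst ξ x φ).WellFormed := by
  induction φ with
  | var p => by_cases h : p = x <;> simp [Formula.subst, h, hξ, WellFormed]
  | fix η y φ ih =>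
    by_cases hy : y = x
    · simpa [Formula.subst, hy] using hφ
    · simp only [Formula.subst, hy, if_false]
      exact ⟨hφ.1.subst (positive_of_notMem_FV hξ (h y (by simp [BV]))),
        ih hφ.2 fun z hz => h z (by simp [BV, hz])⟩
  | conj φ ψ ihφ ihψ =>
    exact ⟨ihφ hφ.1 fun z hz => h z (by simp [BV, hz]), ihψ hφ.2 fun z hz => h z (by simp [BV, hz])⟩
  | disj φ ψ ihφ ihψ =>
    exact ⟨ihφ hφ.1 fun z hz => h z (by simp [BV, hz]), ihψ hφ.2 fun z hz => h z (by simp [BV, hz])⟩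
  | _ => simp_all [Formula.subst, WellFormed, BV]

theorem FV_subst_subset {ξ : Formula V} {x : V} {φ : Formula V} (hφ : φ.Positive x) :
    (subst ξ x φ).FV ⊆ φ.FV.erase x ∪ ξ.FV := by
  induction φ with
  | var p => by_cases h : p = x <;> simp [subst, h, FV]
  | fix η y φ ih =>
    by_cases hy : y = x
    · simp only [subst, hy, if_true, FV]; grind
    · simp only [subst, hy, if_false, FV]
      have := ih hφ
      grind
  | conj φ ψ ihφ ihψ =>
    have h₁ := ihφ hφ.1
    have h₂ := ihψ hφ.2
    simp only [subst, FV]; grind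
  | disj φ ψ ihφ ihψ =>
    have h₁ := ihφ hφ.1
    have h₂ := ihψ hφ.2
    simp only [subst, FV]; grind
  | negVar p => simp only [subst, FV, Positive] at *; grind
  | _ => simp_all [subst, FV, Positive]

theorem BV_subst_subset {ξ : Formula V} {x : V} {φ : Formula V} :
    (subst ξ x φ).BV ⊆ φ.BV ∪ ξ.BV := by
  induction φ with
  | var p => by_cases h : p = x <;> simp [subst, h, BV]
  | fix η y φ ih =>
    by_cases hy : y = x
    · simp only [subst, hy, if_true, BV]; grind
    · simp only [subst, hy, if_false, BV]; grind
  | _ => simp only [subst, BV] at *; grind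

theorem Tidy.of_closStep {φ ψ : Formula V} (hφ : φ.Tidy) (h : ClosStep φ ψ) : ψ.Tidy := by
  obtain ⟨hw, hd⟩ := hφ
  cases h with
  | conj_left ψ χ => exact ⟨hw.1, hd.mono (by simp [FV]) (by simp [BV])⟩
  | conj_right φ ψ => exact ⟨hw.2, hd.mono (by simp [FV]) (by simp [BV])⟩
  | disj_left ψ χ => exact ⟨hw.1, hd.mono (by simp [FV]) (by simp [BV])⟩
  | disj_right φ ψ => exact ⟨hw.2, hd.mono (by simp [FV]) (by simp [BV])⟩
  | dia => exact ⟨hw, hd⟩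
  | box => exact ⟨hw, hd⟩
  | unfold η x χ =>
    refine ⟨WellFormed.subst hw.2 hw fun z hz hm => ?_, hd.mono ?_ ?_⟩
    · exact Finset.disjoint_left.1 hd hm (by simp [BV, hz])
    · exact (FV_subst_subset hw.1).trans (by simp [FV])
    · exact BV_subst_subset.trans (by simp [BV])

/-! ### Free subformulas, inductively -/

/-- `FreeOcc n φ ψ`: there is an occurrence of `φ` at depth `n` in `ψ` which is not in the scope
of a fixpoint operator binding a free variable of `φ`. -/
inductive FreeOcc (φ : Formula V) : ℕ → Formula V → Prop
  | refl : FreeOcc φ 0 φ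
  | conj_left {n : ℕ} {ψ : Formula V} (χ : Formula V) :
      FreeOcc φ n ψ → FreeOcc φ (n + 1) (conj ψ χ)
  | conj_right {n : ℕ} (ψ : Formula V) {χ : Formula V} :
      FreeOcc φ n χ → FreeOcc φ (n + 1) (conj ψ χ)
  | disj_left {n : ℕ} {ψ : Formula V} (χ : Formula V) :
      FreeOcc φ n ψ → FreeOcc φ (n + 1) (disj ψ χ)
  | disj_right {n : ℕ} (ψ : Formula V) {χ : Formula V} :
      FreeOcc φ n χ → FreeOcc φ (n + 1) (disj ψ χ)
  | dia {n : ℕ} {ψ : Formula V} : FreeOcc φ n ψ → FreeOcc φ (n + 1) (dia ψ)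
  | box {n : ℕ} {ψ : Formula V} : FreeOcc φ n ψ → FreeOcc φ (n + 1) (box ψ)
  | fix {n : ℕ} (η : FixOp) {x : V} {ψ : Formula V} (hx : x ∉ φ.FV) :
      FreeOcc φ n ψ → FreeOcc φ (n + 1) (fix η x ψ)

theorem FreeOcc.FV_subset {n : ℕ} {φ ψ : Formula V} (h : FreeOcc φ n ψ) : φ.FV ⊆ ψ.FV := by
  induction h with
  | refl => exact subset_rfl
  | _ => simp only [FV] at *; grind

theorem FreeOcc.trans {m n : ℕ} {φ ψ χ : Formula V} (h : FreeOcc φ m ψ) (h' : FreeOcc ψ n χ) :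
    FreeOcc φ (m + n) χ := by
  induction h' with
  | refl => exact h
  | conj_left _ _ ih => exact .conj_left _ ih
  | conj_right _ _ ih => exact .conj_right _ ih
  | disj_left _ _ ih => exact .disj_left _ ih
  | disj_right _ _ ih => exact .disj_right _ ih
  | dia _ ih => exact .dia ih
  | box _ ih => exact .box ih
  | fix η hx _ ih => exact .fix η (fun hm => hx (h.FV_subset hm)) ih

theorem FreeOcc.add_le_sizeOf {n : ℕ} {φ ψ : Formula V} (h : FreeOcc φ n ψ) :
    n + sizeOf φ ≤ sizeOf ψ := by
  induction h with
  | refl => simp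
  | _ => simp only [conj.sizeOf_spec, disj.sizeOf_spec, dia.sizeOf_spec, box.sizeOf_spec,
      fix.sizeOf_spec]; omega

theorem FreeOcc.antisymm {m n : ℕ} {φ ψ : Formula V} (h : FreeOcc φ m ψ) (h' : FreeOcc ψ n φ) :
    φ = ψ := by
  have h₁ := h.add_le_sizeOf
  have h₂ := h'.add_le_sizeOf
  obtain rfl : m = 0 := by omega
  cases h
  rfl

theorem FreeSub.exists_freeOcc {φ ψ : Formula V} (h : FreeSub φ ψ) : ∃ n, FreeOcc φ n ψ := by
  obtain ⟨ρ, x, -, hx, ⟨hp, hc⟩, rfl⟩ := h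
  induction ρ with
  | top => simp [FV] at hx
  | bot => simp [FV] at hx
  | negVar p => simp_all [FV, Positive]
  | var p =>
    obtain rfl : x = p := by simpa [FV] using hx
    exact ⟨0, by simpa [subst] using FreeOcc.refl⟩
  | conj ρ σ ihρ ihσ =>
    rcases Finset.mem_union.1 hx with hx | hx
    · exact (ihρ hx hp.1 hc.1).imp' _ fun n h => .conj_left _ h
    · exact (ihσ hx hp.2 hc.2).imp' _ fun n h => .conj_right _ h
  | disj ρ σ ihρ ihσ =>
    rcases Finset.mem_union.1 hx with hx | hx
    · exact (ihρ hx hp.1 hc.1).imp' _ fun n h => .disj_left _ h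
    · exact (ihσ hx hp.2 hc.2).imp' _ fun n h => .disj_right _ h
  | dia ρ ih => exact (ih hx hp hc).imp' _ fun n h => .dia h
  | box ρ ih => exact (ih hx hp hc).imp' _ fun n h => .box h
  | fix η y ρ ih =>
    obtain ⟨hxy, hx⟩ := Finset.mem_erase.1 hx
    obtain ⟨hy, hc⟩ := hc.resolve_left fun h => hxy h.symm
    obtain ⟨n, h⟩ := ih hx hp hc
    refine ⟨n + 1, ?_⟩
    rw [subst, if_neg fun h => hxy h.symm]
    exact .fix η (hy hx) h

theorem noCapture_of_notMem_FV {ξ : Formula V} {x : V} {φ : Formula V} (hx : x ∉ φ.FV) :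
    NoCapture ξ x φ := by
  induction φ with
  | fix η y φ ih =>
    by_cases h : y = x
    · exact .inl h
    · have hx : x ∉ φ.FV := fun hm => hx (Finset.mem_erase.2 ⟨fun e => h e.symm, hm⟩)
      exact .inr ⟨fun hm => (hx hm).elim, ih hx⟩
  | _ => simp_all [FV, NoCapture]

/-- Replacing a free occurrence of `φ` in `ψ` by a variable `x` that does not occur in `ψ`. -/
theorem FreeOcc.exists_context {n : ℕ} {φ ψ : Formula V} (h : FreeOcc φ n ψ) (hψ : ψ.WellFormed)
    {x : V} (hx : x ∉ ψ.FV) (hx' : x ∉ ψ.BV) :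
    ∃ ρ : Formula V, ρ.WellFormed ∧ x ∈ ρ.FV ∧ FreeFor φ x ρ ∧ ψ = subst φ x ρ ∧
      ∀ z, ψ.Positive z → ρ.Positive z := by
  induction h with
  | refl => exact ⟨var x, by simp [WellFormed, FV, FreeFor, Positive, NoCapture, subst]⟩
  | conj_left χ _ ih =>
    simp only [FV, BV, Finset.mem_union, not_or] at hx hx'
    obtain ⟨ρ, hw, hm, hf, rfl, hp⟩ := ih hψ.1 hx.1 hx'.1
    exact ⟨conj ρ χ, ⟨hw, hψ.2⟩, Finset.mem_union_left _ hm,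
      ⟨⟨hf.1, positive_of_notMem_FV hψ.2 hx.2⟩, hf.2, noCapture_of_notMem_FV hx.2⟩,
      by simp [subst, subst_of_notMem_FV hx.2], fun z hz => ⟨hp z hz.1, hz.2⟩⟩
  | disj_left χ _ ih =>
    simp only [FV, BV, Finset.mem_union, not_or] at hx hx'
    obtain ⟨ρ, hw, hm, hf, rfl, hp⟩ := ih hψ.1 hx.1 hx'.1
    exact ⟨disj ρ χ, ⟨hw, hψ.2⟩, Finset.mem_union_left _ hm,
      ⟨⟨hf.1, positive_of_notMem_FV hψ.2 hx.2⟩, hf.2, noCapture_of_notMem_FV hx.2⟩,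
      by simp [subst, subst_of_notMem_FV hx.2], fun z hz => ⟨hp z hz.1, hz.2⟩⟩
  | conj_right χ _ ih =>
    simp only [FV, BV, Finset.mem_union, not_or] at hx hx'
    obtain ⟨ρ, hw, hm, hf, rfl, hp⟩ := ih hψ.2 hx.2 hx'.2
    exact ⟨conj χ ρ, ⟨hψ.1, hw⟩, Finset.mem_union_right _ hm,
      ⟨⟨positive_of_notMem_FV hψ.1 hx.1, hf.1⟩, noCapture_of_notMem_FV hx.1, hf.2⟩,
      by simp [subst, subst_of_notMem_FV hx.1], fun z hz => ⟨hz.1, hp z hz.2⟩⟩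
  | disj_right χ _ ih =>
    simp only [FV, BV, Finset.mem_union, not_or] at hx hx'
    obtain ⟨ρ, hw, hm, hf, rfl, hp⟩ := ih hψ.2 hx.2 hx'.2
    exact ⟨disj χ ρ, ⟨hψ.1, hw⟩, Finset.mem_union_right _ hm,
      ⟨⟨positive_of_notMem_FV hψ.1 hx.1, hf.1⟩, noCapture_of_notMem_FV hx.1, hf.2⟩,
      by simp [subst, subst_of_notMem_FV hx.1], fun z hz => ⟨hz.1, hp z hz.2⟩⟩
  | dia _ ih =>
    obtain ⟨ρ, hw, hm, hf, rfl, hp⟩ := ih hψ hx hx'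
    exact ⟨Formula.dia ρ, hw, hm, hf, rfl, hp⟩
  | box _ ih =>
    obtain ⟨ρ, hw, hm, hf, rfl, hp⟩ := ih hψ hx hx'
    exact ⟨Formula.box ρ, hw, hm, hf, rfl, hp⟩
  | @fix n η y ψ hy _ ih =>
    simp only [BV, Finset.mem_insert, not_or] at hx'
    obtain ⟨ρ, hw, hm, hf, rfl, hp⟩ :=
      ih hψ.2 (fun hm => hx (Finset.mem_erase.2 ⟨hx'.1, hm⟩)) hx'.2
    exact ⟨Formula.fix η y ρ, ⟨hp y hψ.1, hw⟩, Finset.mem_erase.2 ⟨hx'.1, hm⟩,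
      ⟨hf.1, .inr ⟨fun _ => hy, hf.2⟩⟩, by rw [Formula.subst, if_neg fun h => hx'.1 h.symm], hp⟩

theorem FreeOcc.freeSub [Infinite V] {n : ℕ} {φ ψ : Formula V} (h : FreeOcc φ n ψ)
    (hψ : ψ.WellFormed) : FreeSub φ ψ := by
  obtain ⟨x, hx⟩ := Infinite.exists_notMem_finset (ψ.FV ∪ ψ.BV)
  simp only [Finset.mem_union, not_or] at hx
  obtain ⟨ρ, hw, hm, hf, e, -⟩ := h.exists_context hψ hx.1 hx.2
  exact ⟨ρ, x, hw, hm, hf, e⟩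

theorem FreeOcc.subst {n : ℕ} {φ ψ ξ : Formula V} {x : V} (h : FreeOcc φ n ψ) (hx : x ∉ φ.FV) :
    FreeOcc φ n (subst ξ x ψ) := by
  induction h with
  | refl => rw [subst_of_notMem_FV hx]; exact .refl
  | conj_left _ _ ih => exact .conj_left _ ih
  | conj_right _ _ ih => exact .conj_right _ ih
  | disj_left _ _ ih => exact .disj_left _ ih
  | disj_right _ _ ih => exact .disj_right _ ih
  | dia _ ih => exact .dia ih
  | box _ ih => exact .box ih
  | @fix n η y ψ hy h ih =>
    by_cases e : y = x
    · simpa [Formula.subst, e] using FreeOcc.fix η hx h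
    · simpa [Formula.subst, e] using FreeOcc.fix η hy ih

theorem FreeOcc.reaches {n : ℕ} {φ ψ : Formula V} (h : FreeOcc φ n ψ) (hψ : ψ.Tidy) :
    Reaches ψ φ := by
  induction n generalizing ψ with
  | zero => cases h; exact .refl
  | succ n ih =>
    suffices ∃ χ, ClosStep ψ χ ∧ FreeOcc φ n χ by
      obtain ⟨χ, hs, ho⟩ := this
      have hχ := hψ.of_closStep hs
      exact .head ⟨hψ, hχ, hs⟩ (ih ho hχ)
    cases h with
    | conj_left _ h => exact ⟨_, .conj_left _ _, h⟩
    | conj_right _ h => exact ⟨_, .conj_right _ _, h⟩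
    | disj_left _ h => exact ⟨_, .disj_left _ _, h⟩
    | disj_right _ h => exact ⟨_, .disj_right _ _, h⟩
    | dia h => exact ⟨_, .dia _, h⟩
    | box h => exact ⟨_, .box _, h⟩
    | fix η hx h => exact ⟨_, .unfold _ _ _, h.subst hx⟩

/-! ### Simultaneous substitution -/

/-- Simultaneous substitution of formulas for the free (positive) occurrences of variables. -/
def msubst (σ : V → Formula V) : Formula V → Formula V
  | top => top
  | bot => bot
  | var p => σ p
  | negVar p => negVar p
  | conj φ ψ => conj (msubst σ φ) (msubst σ ψ)
  | disj φ ψ => disj (msubst σ φ) (msubst σ ψ)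
  | dia φ => dia (msubst σ φ)
  | box φ => box (msubst σ φ)
  | fix η y φ => fix η y (msubst (Function.update σ y (var y)) φ)

theorem msubst_var (φ : Formula V) : msubst var φ = φ := by
  induction φ with
  | fix η y φ ih => simp [msubst, Function.update_eq_self, ih]
  | _ => simp_all [msubst]

theorem BV_subset_BV_msubst (σ : V → Formula V) (φ : Formula V) : φ.BV ⊆ (msubst σ φ).BV := by
  induction φ generalizing σ with
  | conj φ ψ ihφ ihψ => exact Finset.union_subset_union (ihφ σ) (ihψ σ)
  | disj φ ψ ihφ ihψ => exact Finset.union_subset_union (ihφ σ) (ihψ σ)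
  | dia φ ih => exact ih σ
  | box φ ih => exact ih σ
  | fix η y φ ih => exact Finset.insert_subset_insert _ (ih _)
  | _ => simp [BV]

theorem subst_msubst_update (σ : V → Formula V) {y : V} (ξ : Formula V) {φ : Formula V}
    (h : ∀ z ∈ φ.FV, z ≠ y → y ∉ (σ z).FV) :
    subst ξ y (msubst (Function.update σ y (var y)) φ) = msubst (Function.update σ y ξ) φ := by
  induction φ generalizing σ with
  | top => rfl
  | bot => rfl
  | negVar p => rfl
  | var p =>
    by_cases e : p = y
    · subst e; simp [msubst, subst]
    · simp only [msubst, Function.update_of_ne e]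
      exact subst_of_notMem_FV (h p (by simp [FV]) e)
  | conj φ ψ ihφ ihψ =>
    simp only [msubst, subst]
    rw [ihφ σ fun z hz => h z (by simp [FV, hz]), ihψ σ fun z hz => h z (by simp [FV, hz])]
  | disj φ ψ ihφ ihψ =>
    simp only [msubst, subst]
    rw [ihφ σ fun z hz => h z (by simp [FV, hz]), ihψ σ fun z hz => h z (by simp [FV, hz])]
  | dia φ ih => simp only [msubst, subst]; rw [ih σ h]
  | box φ ih => simp only [msubst, subst]; rw [ih σ h]
  | fix η w φ ih =>
    by_cases e : w = y
    · subst e; simp [msubst, subst]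
    · simp only [msubst, subst, e, if_false]
      rw [Function.update_comm (Ne.symm e), ih, Function.update_comm e]
      intro z hz hzy
      by_cases hzw : z = w
      · subst hzw; simpa [FV] using Ne.symm hzy
      · rw [Function.update_of_ne hzw]
        exact h z (Finset.mem_erase.2 ⟨hzw, hz⟩) hzy

theorem FreeOcc.msubst {n : ℕ} {z : V} {φ : Formula V} (h : FreeOcc (var z) n φ)
    (σ : V → Formula V) (hσ : ∀ y ∈ φ.BV, y ∉ (σ z).FV) : ∃ m, FreeOcc (σ z) m (msubst σ φ) := by
  induction h generalizing σ with
  | refl => exact ⟨0, .refl⟩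
  | conj_left _ _ ih =>
    exact (ih σ fun y hy => hσ y (by simp [BV, hy])).imp' _ fun _ h => .conj_left _ h
  | conj_right _ _ ih =>
    exact (ih σ fun y hy => hσ y (by simp [BV, hy])).imp' _ fun _ h => .conj_right _ h
  | disj_left _ _ ih =>
    exact (ih σ fun y hy => hσ y (by simp [BV, hy])).imp' _ fun _ h => .disj_left _ h
  | disj_right _ _ ih =>
    exact (ih σ fun y hy => hσ y (by simp [BV, hy])).imp' _ fun _ h => .disj_right _ h
  | dia _ ih => exact (ih σ hσ).imp' _ fun _ h => .dia h
  | box _ ih => exact (ih σ hσ).imp' _ fun _ h => .box h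
  | @fix n η x ψ hx h ih =>
    have hzx : z ≠ x := fun e => hx (by simp [FV, e])
    obtain ⟨m, hm⟩ := ih (Function.update σ x (var x)) fun y hy => by
      rw [Function.update_of_ne hzx]; exact hσ y (by simp [BV, hy])
    rw [Function.update_of_ne hzx] at hm
    exact ⟨m + 1, .fix η (hσ x (by simp [BV])) hm⟩

/-- No bound variable of `φ` is free in a formula that `σ` puts for a free variable of `φ`. -/
def Avoids (σ : V → Formula V) (φ : Formula V) : Prop :=
  ∀ z ∈ φ.FV, ∀ y ∈ φ.BV, y ∉ (σ z).FV

theorem Avoids.mono {σ : V → Formula V} {φ ψ : Formula V} (h : Avoids σ φ) (hF : ψ.FV ⊆ φ.FV)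
    (hB : ψ.BV ⊆ φ.BV) : Avoids σ ψ :=
  fun z hz y hy => h z (hF hz) y (hB hy)

theorem Avoids.unfold {σ : V → Formula V} {η : FixOp} {y : V} {φ : Formula V}
    (h : Avoids σ (fix η y φ)) (ht : (msubst σ (fix η y φ)).Tidy) :
    Avoids (Function.update σ y (msubst σ (fix η y φ))) φ := by
  intro z hz w hw
  by_cases e : z = y
  · subst e
    rw [Function.update_self]
    exact Finset.disjoint_right.1 ht.2 (BV_subset_BV_msubst _ _ (by simp [BV, hw]))
  · rw [Function.update_of_ne e]
    exact h z (Finset.mem_erase.2 ⟨e, hz⟩) w (by simp [BV, hw])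

theorem Avoids.subst_unfold {σ : V → Formula V} {η : FixOp} {y : V} {φ : Formula V}
    (h : Avoids σ (fix η y φ)) (ξ : Formula V) :
    subst ξ y (msubst (Function.update σ y (var y)) φ) = msubst (Function.update σ y ξ) φ :=
  subst_msubst_update σ ξ fun z hz hzy => h z (Finset.mem_erase.2 ⟨hzy, hz⟩) y (by simp [BV])

theorem Tidy.avoids_var {φ : Formula V} (h : φ.Tidy) : Avoids var φ := by
  intro z hz y hy hm
  obtain rfl : y = z := by simpa [FV] using hm
  exact Finset.disjoint_left.1 h.2 hz hy

/-! ### The closure is finite -/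

theorem exists_finite_closed_msubst {σ : V → Formula V} {φ : Formula V} (hσ : Avoids σ φ)
    (ht : (msubst σ φ).Tidy) :
    ∃ F : Set (Formula V), F.Finite ∧ msubst σ φ ∈ F ∪ σ '' φ.FV ∧
      ∀ α ∈ F, ∀ β, ClosStep α β → β ∈ F ∪ σ '' φ.FV := by
  induction φ generalizing σ with
  | top => exact ⟨{top}, by simp, by simp [msubst], by rintro _ rfl _ ⟨⟩⟩
  | bot => exact ⟨{bot}, by simp, by simp [msubst], by rintro _ rfl _ ⟨⟩⟩
  | var p => exact ⟨∅, by simp, by simp [msubst, FV], by simp⟩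
  | negVar p => exact ⟨{negVar p}, by simp, by simp [msubst], by rintro _ rfl _ ⟨⟩⟩
  | conj φ ψ ihφ ihψ =>
    obtain ⟨F, hF, hm, hc⟩ := ihφ (hσ.mono (by simp [FV]) (by simp [BV]))
      (ht.of_closStep (.conj_left _ _))
    obtain ⟨G, hG, hm', hc'⟩ := ihψ (hσ.mono (by simp [FV]) (by simp [BV]))
      (ht.of_closStep (.conj_right _ _))
    refine ⟨insert (msubst σ (conj φ ψ)) (F ∪ G), (hF.union hG).insert _, by simp, ?_⟩
    simp only [FV, Finset.coe_union, Set.image_union]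
    rintro α (rfl | hα | hα) β hβ
    · cases hβ <;> grind
    · have := hc α hα β hβ; grind
    · have := hc' α hα β hβ; grind
  | disj φ ψ ihφ ihψ =>
    obtain ⟨F, hF, hm, hc⟩ := ihφ (hσ.mono (by simp [FV]) (by simp [BV]))
      (ht.of_closStep (.disj_left _ _))
    obtain ⟨G, hG, hm', hc'⟩ := ihψ (hσ.mono (by simp [FV]) (by simp [BV]))
      (ht.of_closStep (.disj_right _ _))
    refine ⟨insert (msubst σ (disj φ ψ)) (F ∪ G), (hF.union hG).insert _, by simp, ?_⟩
    simp only [FV, Finset.coe_union, Set.image_union]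
    rintro α (rfl | hα | hα) β hβ
    · cases hβ <;> grind
    · have := hc α hα β hβ; grind
    · have := hc' α hα β hβ; grind
  | dia φ ih =>
    obtain ⟨F, hF, hm, hc⟩ := ih hσ (ht.of_closStep (.dia _))
    refine ⟨insert (msubst σ (dia φ)) F, hF.insert _, by simp, ?_⟩
    simp only [FV]
    rintro α (rfl | hα) β hβ
    · cases hβ; grind
    · have := hc α hα β hβ; grind
  | box φ ih =>
    obtain ⟨F, hF, hm, hc⟩ := ih hσ (ht.of_closStep (.box _))
    refine ⟨insert (msubst σ (box φ)) F, hF.insert _, by simp, ?_⟩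
    simp only [FV]
    rintro α (rfl | hα) β hβ
    · cases hβ; grind
    · have := hc α hα β hβ; grind
  | fix η y φ ih =>
    set ξ := msubst σ (fix η y φ) with hξ
    have hu := hσ.subst_unfold ξ
    have hs : ClosStep ξ (msubst (Function.update σ y ξ) φ) := by
      rw [← hu]; exact .unfold _ _ _
    obtain ⟨F, hF, hm, hc⟩ := ih (hσ.unfold ht) (ht.of_closStep hs)
    have key : F ∪ Function.update σ y ξ '' φ.FV ⊆ insert ξ F ∪ σ '' (fix η y φ).FV := by
      rintro α (hα | ⟨z, hz, rfl⟩)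
      · exact .inl (.inr hα)
      · by_cases e : z = y
        · subst e; simp
        · rw [Function.update_of_ne e]
          exact .inr ⟨z, Finset.mem_erase.2 ⟨e, hz⟩, rfl⟩
    refine ⟨insert ξ F, hF.insert _, by simp, ?_⟩
    rintro α (rfl | hα) β hβ
    · rw [hξ, msubst] at hβ
      cases hβ
      rw [← msubst, ← hξ, hu]
      exact key hm
    · exact key (hc α hα β hβ)

theorem finite_setOf_reaches {φ : Formula V} (hφ : φ.Tidy) : {ψ | Reaches φ ψ}.Finite := by
  obtain ⟨F, hF, hm, hc⟩ := exists_finite_closed_msubst hφ.avoids_var (by rwa [msubst_var])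
  rw [msubst_var] at hm
  refine (hF.union (φ.FV.finite_toSet.image var)).subset fun ψ hψ => ?_
  induction (hψ : Relation.ReflTransGen _ _ _) with
  | refl => exact hm
  | tail _ hs ih =>
    rcases ih with h | ⟨z, -, rfl⟩
    · exact hc _ h _ hs.2.2
    · cases hs.2.2

/-! ### Infinite traces -/

/-- From time `n` on, the trace visits `ξ` again and again, and `ξ` remains a free subformula. -/
def SettlesAt (τ : ℕ → Formula V) (ξ : Formula V) (n : ℕ) : Prop :=
  τ n = ξ ∧ (∀ k, ∃ m ≥ n + k, τ m = ξ) ∧ ∀ i ≥ n, ∃ d, FreeOcc ξ d (τ i)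

/-- After time `n` the trace arrives at `σ z`, for some free variable `z` of `φ`, and until then
`σ z` remains a free subformula. -/
def Exits (τ : ℕ → Formula V) (σ : V → Formula V) (φ : Formula V) (n : ℕ) : Prop :=
  ∃ (z : V) (m : ℕ), n ≤ m ∧ τ m = σ z ∧ (∃ d, FreeOcc (var z) d φ) ∧
    ∀ i, n ≤ i → i ≤ m → ∃ d, FreeOcc (σ z) d (τ i)

theorem Exits.of_succ {τ : ℕ → Formula V} {σ : V → Formula V} {φ ψ : Formula V} {n : ℕ}
    (h : Exits τ σ ψ (n + 1)) (hσ : Avoids σ φ) (hn : τ n = msubst σ φ)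
    (hψ : ∀ z d, FreeOcc (var z) d ψ → FreeOcc (var z) (d + 1) φ) : Exits τ σ φ n := by
  obtain ⟨z, m, hm, he, ⟨d, hd⟩, hi⟩ := h
  have hd := hψ z d hd
  refine ⟨z, m, by omega, he, ⟨_, hd⟩, fun i hni him => ?_⟩
  rcases hni.eq_or_lt with rfl | hni
  · rw [hn]
    exact hd.msubst σ (hσ z (hd.FV_subset (by simp [FV])))
  · exact hi i hni him

theorem exits_or_settlesAt {τ : ℕ → Formula V} (hτ : IsInfiniteTrace τ) {φ : Formula V}
    {σ : V → Formula V} (hσ : Avoids σ φ) {n : ℕ} (hn : τ n = msubst σ φ) :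
    Exits τ σ φ n ∨ ∃ (ξ : Formula V) (m : ℕ), ξ.IsFixpoint ∧ SettlesAt τ ξ m := by
  have hs := (hτ.2 n).2.2
  rw [hn] at hs
  induction φ generalizing σ n with
  | top => cases hs
  | bot => cases hs
  | negVar p => cases hs
  | var p =>
    refine .inl ⟨p, n, le_rfl, hn, ⟨0, .refl⟩, fun i h h' => ?_⟩
    obtain rfl := le_antisymm h h'
    exact ⟨0, by rw [hn]; exact .refl⟩
  | conj φ ψ ihφ ihψ =>
    rw [msubst] at hs
    generalize hα : τ (n + 1) = α at hs
    cases hs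
    · exact (ihφ (hσ.mono (by simp [FV]) (by simp [BV])) hα (hα ▸ (hτ.2 _).2.2)).imp_left
        fun h => h.of_succ hσ hn fun z d hd => .conj_left _ hd
    · exact (ihψ (hσ.mono (by simp [FV]) (by simp [BV])) hα (hα ▸ (hτ.2 _).2.2)).imp_left
        fun h => h.of_succ hσ hn fun z d hd => .conj_right _ hd
  | disj φ ψ ihφ ihψ =>
    rw [msubst] at hs
    generalize hα : τ (n + 1) = α at hs
    cases hs
    · exact (ihφ (hσ.mono (by simp [FV]) (by simp [BV])) hα (hα ▸ (hτ.2 _).2.2)).imp_left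
        fun h => h.of_succ hσ hn fun z d hd => .disj_left _ hd
    · exact (ihψ (hσ.mono (by simp [FV]) (by simp [BV])) hα (hα ▸ (hτ.2 _).2.2)).imp_left
        fun h => h.of_succ hσ hn fun z d hd => .disj_right _ hd
  | dia φ ih =>
    rw [msubst] at hs
    generalize hα : τ (n + 1) = α at hs
    cases hs
    exact (ih hσ hα (hα ▸ (hτ.2 _).2.2)).imp_left
      fun h => h.of_succ hσ hn fun z d hd => .dia hd
  | box φ ih =>
    rw [msubst] at hs
    generalize hα : τ (n + 1) = α at hs
    cases hs
    exact (ih hσ hα (hα ▸ (hτ.2 _).2.2)).imp_left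
      fun h => h.of_succ hσ hn fun z d hd => .box hd
  | fix η y φ ih =>
    by_contra! hE
    obtain ⟨hE, hD⟩ := hE
    set ξ := msubst σ (fix η y φ) with hξ
    have hfix : ξ.IsFixpoint := ⟨η, y, _, rfl⟩
    have visits : ∀ k, ∃ m ≥ n + k, τ m = ξ ∧ ∀ i, n ≤ i → i ≤ m → ∃ d, FreeOcc ξ d (τ i) := by
      intro k
      induction k with
      | zero =>
        refine ⟨n, le_rfl, hn, fun i h h' => ?_⟩
        obtain rfl := le_antisymm h h'
        exact ⟨0, by rw [hn]; exact .refl⟩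
      | succ k ihk =>
        obtain ⟨m, hm, hmξ, hocc⟩ := ihk
        have hnext : τ (m + 1) = msubst (Function.update σ y ξ) φ := by
          have hs := (hτ.2 m).2.2
          generalize τ (m + 1) = α at hs
          rw [hmξ, hξ, msubst] at hs
          cases hs
          rw [← msubst, ← hξ, hσ.subst_unfold ξ]
        have htidy : ξ.Tidy := hn ▸ hτ.1 n
        rcases ih (hσ.unfold htidy) hnext (hnext ▸ (hτ.2 _).2.2) with
          ⟨z, m', hm', he, ⟨d, hd⟩, hi⟩ | ⟨ζ, l, hζ, hl⟩
        · by_cases hzy : z = y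
          · subst hzy
            rw [Function.update_self] at he hi
            refine ⟨m', by omega, he, fun i hni him => ?_⟩
            rcases le_or_gt i m with h | h
            · exact hocc i hni h
            · exact hi i h him
          · rw [Function.update_of_ne hzy] at he hi
            have hd' : FreeOcc (var z) (d + 1) (fix η y φ) :=
              .fix η (by simpa [FV] using Ne.symm hzy) hd
            obtain ⟨e, hz⟩ := hd'.msubst σ (hσ z (hd'.FV_subset (by simp [FV])))
            refine (hE ⟨z, m', by omega, he, ⟨_, hd'⟩, fun i hni him => ?_⟩).elim
            rcases le_or_gt i m with h | h
            · obtain ⟨e', hi'⟩ := hocc i hni h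
              exact ⟨_, hz.trans hi'⟩
            · exact hi i h him
        · exact (hD ζ l hζ hl).elim
    refine hD ξ n hfix ⟨hn, fun k => (visits k).imp fun m h => ⟨h.1, h.2.1⟩, fun i hi => ?_⟩
    obtain ⟨m, hm, -, hocc⟩ := visits i
    exact hocc i hi (by omega)

theorem exists_settlesAt {τ : ℕ → Formula V} (hτ : IsInfiniteTrace τ) :
    ∃ (ξ : Formula V) (m : ℕ), ξ.IsFixpoint ∧ SettlesAt τ ξ m := by
  refine (exits_or_settlesAt hτ (hτ.1 0).avoids_var (msubst_var _).symm).resolve_left ?_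
  rintro ⟨z, m, -, hm, -⟩
  have hs := (hτ.2 m).2.2
  rw [hm] at hs
  cases hs

theorem IsInfiniteTrace.reaches {τ : ℕ → Formula V} (hτ : IsInfiniteTrace τ) {m n : ℕ}
    (h : m ≤ n) : Reaches (τ m) (τ n) := by
  induction n, h using Nat.le_induction with
  | base => exact .refl
  | succ n _ ih => exact ih.tail (hτ.2 n)

theorem OccursInfinitelyOften.exists_ge {V : Type*} {τ : ℕ → Formula V} {φ : Formula V}
    (h : OccursInfinitelyOften τ φ) (n : ℕ) : ∃ m ≥ n, τ m = φ := by
  obtain ⟨m, hm, hnm⟩ := h.exists_gt n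
  exact ⟨m, hnm.le, hm⟩

theorem OccursInfinitelyOften.reaches {τ : ℕ → Formula V} (hτ : IsInfiniteTrace τ)
    {φ ψ : Formula V} (hφ : OccursInfinitelyOften τ φ) (hψ : OccursInfinitelyOften τ ψ) :
    Reaches φ ψ := by
  obtain ⟨m, -, rfl⟩ := hφ.exists_ge 0
  obtain ⟨n, hn, rfl⟩ := hψ.exists_ge m
  exact hτ.reaches hn

theorem OccursInfinitelyOften.tidy {τ : ℕ → Formula V} (hτ : IsInfiniteTrace τ)
    {φ : Formula V} (hφ : OccursInfinitelyOften τ φ) : φ.Tidy := by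
  obtain ⟨m, -, rfl⟩ := hφ.exists_ge 0
  exact hτ.1 m

theorem SettlesAt.dominates [Infinite V] {τ : ℕ → Formula V} (hτ : IsInfiniteTrace τ)
    {ξ : Formula V} {n : ℕ} (hξ : ξ.IsFixpoint) (h : SettlesAt τ ξ n) : Dominates τ ξ := by
  obtain ⟨hn, hv, ho⟩ := h
  refine ⟨hξ, Set.infinite_of_not_bddAbove ?_, ?_⟩
  · rintro ⟨B, hB⟩
    obtain ⟨m, hm, he⟩ := hv (B + 1)
    have := hB he
    omega
  · rw [Nat.cofinite_eq_atTop]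
    filter_upwards [Filter.eventually_ge_atTop n] with i hi
    refine ⟨FreeOcc.refl.freeSub (hn ▸ (hτ.1 n).1), ?_⟩
    induction i, hi using Nat.le_induction with
    | base => rw [hn]
    | succ i hi ih =>
      obtain ⟨d, hd⟩ := ho (i + 1) (by omega)
      exact ih.tail ⟨hτ.2 i, hd.freeSub (hτ.1 _).1⟩

theorem Dominates.prioLE {τ : ℕ → Formula V} {ξ φ : Formula V} (h : Dominates τ ξ)
    (hφ : OccursInfinitelyOften τ φ) : PrioLE φ ξ := by
  have h' := h.2.2
  rw [Nat.cofinite_eq_atTop, Filter.eventually_atTop] at h'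
  obtain ⟨n, hn⟩ := h'
  obtain ⟨m, hm, rfl⟩ := hφ.exists_ge n
  exact hn m hm

/-! ### The closure priority order and alternating chains -/

theorem PrioLE.exists_freeOcc {φ ψ : Formula V} (h : PrioLE φ ψ) : ∃ n, FreeOcc ψ n φ := by
  obtain ⟨h₀, h⟩ := h
  induction h with
  | refl => exact h₀.exists_freeOcc
  | tail _ hs _ => exact hs.2.exists_freeOcc

theorem PrioLE.reaches {φ ψ : Formula V} (h : PrioLE φ ψ) : Reaches ψ φ :=
  Relation.ReflTransGen.mono (fun _ _ hs => hs.1) _ _ h.2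

theorem PrioLE.reaches_symm {φ ψ : Formula V} (h : PrioLE φ ψ) (hφ : φ.Tidy) : Reaches φ ψ := by
  obtain ⟨n, hn⟩ := h.exists_freeOcc
  exact hn.reaches hφ

theorem PrioLE.antisymm {φ ψ : Formula V} (h : PrioLE φ ψ) (h' : PrioLE ψ φ) : φ = ψ := by
  obtain ⟨m, hm⟩ := h.exists_freeOcc
  obtain ⟨n, hn⟩ := h'.exists_freeOcc
  exact hn.antisymm hm

theorem PrioLE.trans [Infinite V] {φ ψ χ : Formula V} (h : PrioLE φ ψ) (h' : PrioLE ψ χ) :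
    PrioLE φ χ := by
  obtain ⟨m, hm⟩ := h'.exists_freeOcc
  refine ⟨h'.1, h'.2.trans (Relation.ReflTransGen.mono (fun α β hs => ⟨hs.1, ?_⟩) _ _ h.2)⟩
  obtain ⟨n, hn⟩ := hs.2.exists_freeOcc
  exact (hm.trans hn).freeSub hs.1.2.1.1

theorem PrioLT.trans [Infinite V] {φ ψ χ : Formula V} (h : PrioLT φ ψ) (h' : PrioLT ψ χ) :
    PrioLT φ χ :=
  ⟨h.1.trans h'.1, fun h'' => h.2 (h'.1.trans h'')⟩

instance [Infinite V] : IsTrans (Formula V) PrioLT :=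
  ⟨fun _ _ _ => PrioLT.trans⟩

theorem IsAltChain.pairwise [Infinite V] {l : List (Formula V)} (h : IsAltChain l) :
    l.Pairwise PrioLT :=
  (h.2.imp fun _ _ hs => hs.1).pairwise

theorem IsAltChain.nodup [Infinite V] {l : List (Formula V)} (h : IsAltChain l) : l.Nodup :=
  h.pairwise.imp fun {_ _} hs e => by subst e; exact hs.2 hs.1

theorem IsAltChain.mem_cluster [Infinite V] {l : List (Formula V)} {φ : Formula V}
    (h : IsAltChain l) (hl : l.head? = some φ) : ∀ ψ ∈ l, ψ ∈ cluster φ := by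
  obtain ⟨t, rfl⟩ := List.head?_eq_some_iff.1 hl
  intro ψ hψ
  refine ⟨(h.1 ψ hψ).1, ?_⟩
  rcases List.mem_cons.1 hψ with rfl | hψ
  · exact ⟨.refl, .refl⟩
  · have hle := ((List.pairwise_cons.1 h.pairwise).1 ψ hψ).1
    exact ⟨hle.reaches_symm (h.1 φ (by simp)).1, hle.reaches⟩

theorem bddAbove_length_altChain [Infinite V] {φ : Formula V} (hφ : φ.Tidy) :
    BddAbove {n | ∃ l : List (Formula V), IsAltChain l ∧ (∀ ψ ∈ l, ψ ∈ cluster φ) ∧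
      l.length = n} := by
  classical
  refine ⟨(finite_setOf_reaches hφ).toFinset.card, ?_⟩
  rintro _ ⟨l, hl, hm, rfl⟩
  rw [← List.toFinset_card_of_nodup hl.nodup]
  refine Finset.card_le_card fun ψ hψ => ?_
  simpa using (hm ψ (List.mem_toFinset.1 hψ)).2.1

theorem IsAltChain.length_le_hUp [Infinite V] {l : List (Formula V)} {φ : Formula V}
    (hφ : φ.Tidy) (h : IsAltChain l) (hl : l.head? = some φ) : l.length ≤ hUp φ := by
  refine le_csSup ((bddAbove_length_altChain hφ).mono ?_) ⟨l, h, hl, rfl⟩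
  rintro _ ⟨l, h, hl, rfl⟩
  exact ⟨l, h, h.mem_cluster hl, rfl⟩

theorem exists_altChain_length_eq_hUp [Infinite V] {φ : Formula V} (hφ : φ.Tidy)
    (hfix : φ.IsFixpoint) :
    ∃ l : List (Formula V), IsAltChain l ∧ l.head? = some φ ∧ l.length = hUp φ := by
  refine Nat.sSup_mem (s := {n | ∃ l : List (Formula V), IsAltChain l ∧ l.head? = some φ ∧
    l.length = n}) ⟨1, [φ], ⟨by simp [hφ, hfix], by simp⟩, rfl, rfl⟩
    ((bddAbove_length_altChain hφ).mono ?_)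
  rintro _ ⟨l, h, hl, rfl⟩
  exact ⟨l, h, h.mem_cluster hl, rfl⟩

theorem hUp_le_closureDepth [Infinite V] {φ : Formula V} (hφ : φ.Tidy) (hfix : φ.IsFixpoint) :
    hUp φ ≤ closureDepth (cluster φ) := by
  obtain ⟨l, h, hl, e⟩ := exists_altChain_length_eq_hUp hφ hfix
  exact le_csSup (bddAbove_length_altChain hφ) ⟨l, h, h.mem_cluster hl, e⟩

theorem AltStep.hUp_lt [Infinite V] {φ ψ : Formula V} (h : AltStep φ ψ) (hφ : φ.Tidy)
    (hψ : ψ.Tidy) : hUp ψ < hUp φ := by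
  have hs := h
  obtain ⟨-, η, x, χ, y, δ, hφ', hψ'⟩ := h
  obtain ⟨l, hl, hh, e⟩ := exists_altChain_length_eq_hUp hψ ⟨_, _, _, hψ'⟩
  obtain ⟨t, rfl⟩ := List.head?_eq_some_iff.1 hh
  rw [← e, ← Nat.succ_le_iff]
  refine IsAltChain.length_le_hUp (l := φ :: ψ :: t) hφ ⟨?_, .cons_cons hs hl.2⟩ rfl
  rintro α hα
  rcases List.mem_cons.1 hα with rfl | hα
  · exact ⟨hφ, _, _, _, hφ'⟩
  · exact hl.1 α hα

theorem PrioLT.hUp_le [Infinite V] {η : FixOp} {x y : V} {χ δ : Formula V}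
    (h : PrioLT (fix η x χ) (fix η y δ)) (hφ : (fix η x χ).Tidy) (hψ : (fix η y δ).Tidy) :
    hUp (fix η y δ) ≤ hUp (fix η x χ) := by
  obtain ⟨l, hl, hh, e⟩ := exists_altChain_length_eq_hUp hψ ⟨_, _, _, rfl⟩
  obtain ⟨t, rfl⟩ := List.head?_eq_some_iff.1 hh
  rw [← e]
  refine IsAltChain.length_le_hUp (l := fix η x χ :: t) hφ ⟨?_, ?_⟩ rfl
  · rintro α hα
    rcases List.mem_cons.1 hα with rfl | hα
    · exact ⟨hφ, _, _, _, rfl⟩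
    · exact hl.1 α (List.mem_cons_of_mem _ hα)
  · cases t with
    | nil => simp
    | cons α t =>
      obtain ⟨⟨hs, η', x', χ', y', δ', e₁, e₂⟩, ht⟩ := List.isChain_cons_cons.1 hl.2
      obtain ⟨rfl, -, -⟩ := Formula.fix.inj e₁
      exact .cons_cons ⟨h.trans hs, _, _, _, _, _, rfl, e₂⟩ ht

theorem cluster_eq_of_reaches {φ ψ : Formula V} (h : Reaches φ ψ) (h' : Reaches ψ φ) :
    cluster φ = cluster ψ :=
  Set.ext fun _ => ⟨fun ⟨ht, h₁, h₂⟩ => ⟨ht, h'.trans h₁, h₂.trans h⟩,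
    fun ⟨ht, h₁, h₂⟩ => ⟨ht, h.trans h₁, h₂.trans h'⟩⟩

open Classical in
theorem even_ite_isParityOf (η : FixOp) (d : ℕ) :
    Even (if η.IsParityOf d then d else d + 1) ↔ η = .nu := by
  split_ifs with h <;> cases η <;> simpa [FixOp.IsParityOf, Nat.even_add_one] using h

open Classical in
theorem ite_isParityOf_mono (η : FixOp) {d e : ℕ} (h : d ≤ e) :
    (if η.IsParityOf d then d else d + 1) ≤ if η.IsParityOf e then e else e + 1 := by
  rcases h.eq_or_lt with rfl | h
  · rfl
  · split_ifs <;> omega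

theorem globalPriority_le_of_prioLE [Infinite V] {φ ψ : Formula V} {k m : ℕ} (h : PrioLE φ ψ)
    (hφ : φ.Tidy) (hψ : ψ.Tidy) (hk : globalPriority φ = some k)
    (hm : globalPriority ψ = some m) : k ≤ m := by
  by_cases h' : PrioLE ψ φ
  · obtain rfl := h.antisymm h'
    exact (Option.some.inj (hk.symm.trans hm)).le
  have hlt : PrioLT φ ψ := ⟨h, h'⟩
  have hc := cluster_eq_of_reaches (h.reaches_symm hφ) h.reaches
  cases φ with
  | fix η x χ =>
    cases ψ with
    | fix θ y δ =>
      have hD := hUp_le_closureDepth hφ ⟨_, _, _, rfl⟩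
      simp only [globalPriority, Option.some.injEq] at hk hm
      subst hk hm
      rw [hc] at hD ⊢
      by_cases e : η = θ
      · subst e
        have := hlt.hUp_le hφ hψ
        exact ite_isParityOf_mono _ (by omega)
      · obtain rfl : θ = η.dual := by cases η <;> cases θ <;> simp_all [FixOp.dual]
        have := AltStep.hUp_lt ⟨hlt, _, _, _, _, _, rfl, rfl⟩ hφ hψ
        split_ifs <;> omega
    | _ => simp [globalPriority] at hm
  | _ => simp [globalPriority] at hk

end Formula

end ModalMu

open ModalMu.Formula in
theorem propositionp {V : Type*} [DecidableEq V] [Infinite V]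
    (τ : ℕ → ModalMu.Formula V) (hτ : ModalMu.Formula.IsInfiniteTrace τ) :
    (∃! ξ : ModalMu.Formula V, ModalMu.Formula.Dominates τ ξ) ∧
    ∀ (η : ModalMu.FixOp) (x : V) (χ : ModalMu.Formula V),
      ModalMu.Formula.Dominates τ (ModalMu.Formula.fix η x χ) →
      ∃ m : ℕ,
        IsGreatest {k : ℕ | ∃ φ : ModalMu.Formula V,
          ModalMu.Formula.OccursInfinitelyOften τ φ ∧
          ModalMu.Formula.globalPriority φ = some k} m ∧
        (Even m ↔ η = ModalMu.FixOp.nu) := by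
  refine ⟨?_, fun η x χ h => ⟨_, ⟨⟨_, h.2.1, rfl⟩, ?_⟩, even_ite_isParityOf η _⟩⟩
  · obtain ⟨ξ, n, hξ, h⟩ := exists_settlesAt hτ
    have hd := h.dominates hτ hξ
    exact ⟨ξ, hd, fun ζ hζ => (hd.prioLE hζ.2.1).antisymm (hζ.prioLE hd.2.1)⟩
  · rintro k ⟨φ, hφ, hk⟩
    exact globalPriority_le_of_prioLE (h.prioLE hφ) (hφ.tidy hτ) (h.2.1.tidy hτ) hk rfl
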